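/- **Setting.** Fix a universal machine $U$, i.e. a partial recursive function taking a program $p\in\{0,1\}^*$ and a condition $y\in\mathbb N$ such that for every partial recursive $T$ there is a constant $c$ so that $T(p,y)=x$ implies $U(q,y)=x$ for some $q$ with $|q|\le|p|+c$. Let $C(x\mid y)$ be the least length of a program $p$ with $U(p,y)=x$. For a graph $G$ on the nodes $1,\dots,n$ let $E(G)\in\{0,1\}^{n(n-1)/2}$ be its adjacency code (the pairs $u<v$ in lexicographical order). For $\delta:\mathbb N\to\mathbb N$, $G$ is $\delta(n)$-random if $C(E(G)\mid n,\delta(n))\ge n(n-1)/2-\delta(n)$. A port assignment matches, at every node $u$ of degree $d$, the ports $1,\dots,d$ bijectively with the edges incident to $u$. A routing scheme on $G$ consists of a port assignment, a label $\ell(u)\in\{0,1\}^*$ and a stored string $F(u)\in\{0,1\}^*$ for every node $u$. Stored strings are interpreted by a fixed partial recursive function $R$ (the language in which routing functions are written): for a message with destination $v\ne u$, node $u$ uses the port with number $R(F(u),\ell(u),\deg u,n,\ell(v))$; in particular, nodes do not know the labels of their neighbours. The scheme is a shortest path routing scheme if, for all nodes $u,v$, the route from $u$ to $v$ obtained in this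 way is a path of length $\mathrm{dist}(u,v)$. The port assignment is either fixed in advance (IA) or may be chosen by the scheme (IB). The labels are either $\ell(u)=u$ in binary ($\alpha$), or $\ell(u)=\sigma(u)$ in binary for a permutation $\sigma$ of $\{1,\dots,n\}$ ($\beta$), or arbitrary distinct binary strings ($\gamma$). The total number of bits of the scheme is $\sum_u|F(u)|$ in models $\alpha,\beta$ and $\sum_u(|F(u)|+|\ell(u)|)$ in model $\gamma$. **Theorem.** Let $U$ and $R$ be as above and let $\delta:\mathbb N\to\mathbb N$ satisfy $\delta(n)=o(n)$. There is a function $g$ with $g(n)=o(n^2)$ such that for every $n$, every $\delta(n)$-random graph $G$ on $n$ nodes, and each of the models IA, IB combined with any of $\alpha,\beta,\gamma$ (in particular with free relabeling $\gamma$), every shortest path routing scheme on $G$ that the model allows has a total of at least $n^2/32-g(n)$ bits. -/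

import Mathlib

open Filter Asymptotics

/-! ### Kolmogorov complexity -/

/-- `U` is a universal (additively optimal) machine for conditional descriptions. A machine is a
partial recursive function which receives a program (a binary string) and a condition
(a natural number) and may output a binary string. -/
def IsUniversal (U : List Bool × ℕ →. List Bool) : Prop :=
  Partrec U ∧ ∀ T : List Bool × ℕ →. List Bool, Partrec T →
    ∃ c : ℕ, ∀ (p : List Bool) (y : ℕ) (x : List Bool), x ∈ T (p, y) →
      ∃ q : List Bool, q.length ≤ p.length + c ∧ x ∈ U (q, y)

/-- The Kolmogorov complexity `C(x | y)` relative to the machine `U`. -/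
noncomputable def kolmogorovComplexity (U : List Bool × ℕ →. List Bool) (x : List Bool) (y : ℕ) :
    ℕ :=
  sInf {k : ℕ | ∃ p : List Bool, p.length = k ∧ x ∈ U (p, y)}

/-- The machine that on program `1^i 0 p` and condition `y` simulates the `i`-th partial recursive
function on `(p, y)`. -/
def referenceMachine (w : List Bool × ℕ) : Part (List Bool) :=
  let i := w.1.findIdx (fun b => !b)
  let p := (List.tail)^[i + 1] w.1
  (Nat.Partrec.Code.eval (Denumerable.ofNat Nat.Partrec.Code i) (Encodable.encode (p, w.2))).bind
    (fun m => Part.ofOption (Encodable.decode (α := List Bool) m))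

/-- Universal machines exist. -/
theorem isUniversal_referenceMachine : IsUniversal referenceMachine := by
  have hi : Primrec (fun w : List Bool × ℕ => w.1.findIdx (fun b => !b)) :=
    Primrec.list_findIdx Primrec.fst (Primrec.not.comp Primrec.snd).to₂
  have hp : Primrec (fun w : List Bool × ℕ =>
      (List.tail)^[w.1.findIdx (fun b => !b) + 1] w.1) :=
    Primrec.nat_iterate (Primrec.succ.comp hi) Primrec.fst
      (Primrec.list_tail.comp Primrec.snd).to₂
  refine ⟨?_, ?_⟩
  · refine Partrec.bind (Nat.Partrec.Code.eval_part.comp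
      ((Computable.ofNat Nat.Partrec.Code).comp hi.to_comp)
      (Computable.encode.comp (hp.to_comp.pair Computable.snd))) ?_
    exact Computable.ofOption (Computable.decode.comp Computable.snd)
  · intro T hT
    obtain ⟨cd, hcd⟩ := Nat.Partrec.Code.exists_code.1 hT
    refine ⟨Encodable.encode cd + 1, fun p y x hx => ?_⟩
    refine ⟨List.replicate (Encodable.encode cd) true ++ false :: p, by simp; omega, ?_⟩
    have h1 : ∀ k : ℕ, (List.replicate k true ++ false :: p).findIdx (fun b => !b) = k := by
      intro k
      induction k with
      | zero => simp [List.findIdx_cons]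
      | succ k ih => simp [List.replicate_succ, List.findIdx_cons, ih]
    have h2 : ∀ k : ℕ, (List.tail)^[k + 1] (List.replicate k true ++ false :: p) = p := by
      intro k
      induction k with
      | zero => simp
      | succ k ih =>
        rw [Function.iterate_succ_apply]
        simpa [List.replicate_succ] using ih
    simp only [referenceMachine, h1, h2, Denumerable.ofNat_encode, hcd]
    simp only [Encodable.encodek, Part.coe_some, Part.bind_some, Part.mem_bind_iff,
      Part.mem_map_iff]
    exact ⟨Encodable.encode x, ⟨x, hx, rfl⟩, by simp⟩

/-! ### Random labelled graphs -/

open Classical in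
/-- The standard code `E(G)`: for the possible edges `uv`, `u < v`, in lexicographical order, one
bit telling whether the edge is present. It has length `n(n-1)/2`. -/
noncomputable def graphCode {n : ℕ} (G : SimpleGraph (Fin n)) : List Bool :=
  (List.finRange n).flatMap fun u =>
    ((List.finRange n).filter fun v => u < v).map fun v => decide (G.Adj u v)

/-- `G` is `δ(n)`-random: `C(E(G) | n, δ(n)) ≥ n(n-1)/2 - δ(n)`, where `n(n-1)/2` is the binary
logarithm of the number of labelled graphs on `n` nodes. -/
def IsRandomGraph (U : List Bool × ℕ →. List Bool) (δ : ℕ → ℕ) {n : ℕ}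
    (G : SimpleGraph (Fin n)) : Prop :=
  (n : ℝ) * ((n : ℝ) - 1) / 2 - (δ n : ℝ) ≤
    (kolmogorovComplexity U (graphCode G) (Nat.pair n (δ n)) : ℝ)

/-! ### Routing schemes -/

/-- The number of neighbours of `u`. -/
noncomputable def nodeDegree {n : ℕ} (G : SimpleGraph (Fin n)) (u : Fin n) : ℕ :=
  (G.neighborSet u).ncard

/-- A port assignment: at each node `u` of degree `d`, the ports `1, …, d` are matched bijectively
with the incident edges (that is, with the neighbours of `u`). -/
abbrev PortAssignment {n : ℕ} (G : SimpleGraph (Fin n)) : Type :=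
  (u : Fin n) → Set.Icc 1 (nodeDegree G u) ≃ G.neighborSet u

/-- What a node can use to route a message, when it does not know its neighbours:
the bits stored there for its routing function, its own label, its number of ports, the number `n`
of nodes of the network, and the label of the destination. -/
structure RouterInput where
  stored : List Bool
  ownLabel : List Bool
  ports : ℕ
  size : ℕ
  destination : List Bool

/-- A language for local routing functions: a partial function that, run on what a node can use,
returns the number of a port. -/
abbrev RouterLanguage : Type := RouterInput →. ℕ

/-- The language is effective: it is a partial recursive function of the five inputs. -/
def RouterLanguage.Effective (R : RouterLanguage) : Prop :=
  Partrec fun t : List Bool × List Bool × ℕ × ℕ × List Bool =>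
    R ⟨t.1, t.2.1, t.2.2.1, t.2.2.2.1, t.2.2.2.2⟩

/-- A routing scheme on `G`: the port assignment and the node labels in use, and for each node the
binary string that encodes its local routing function. -/
structure RoutingScheme {n : ℕ} (G : SimpleGraph (Fin n)) where
  port : PortAssignment G
  label : Fin n → List Bool
  stored : Fin n → List Bool

namespace RoutingScheme

variable {n : ℕ} {G : SimpleGraph (Fin n)}

/-- The local routing function of `u` sends messages with destination `v` over a port of `u`
that leads to the neighbour `w`. -/
def Forwards (R : RouterLanguage) (S : RoutingScheme G) (u v w : Fin n) : Prop :=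
  ∃ i : Set.Icc 1 (nodeDegree G u),
    (i : ℕ) ∈ R ⟨S.stored u, S.label u, nodeDegree G u, n, S.label v⟩ ∧ (S.port u i : Fin n) = w

/-- Every edge of the walk to `v` is the one chosen by the local routing function for
destination `v`. -/
def Follows (R : RouterLanguage) (S : RoutingScheme G) {v : Fin n} : {u : Fin n} → G.Walk u v → Prop
  | _, .nil => True
  | u, .cons (v := w) _ q => S.Forwards R u v w ∧ S.Follows R q

/-- Shortest path routing: between every pair of nodes, the route described by the scheme
is a shortest path. -/
def IsShortestPath (R : RouterLanguage) (S : RoutingScheme G) : Prop :=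
  ∀ u v : Fin n, ∃ q : G.Walk u v, S.Follows R q ∧ q.length = G.dist u v

end RoutingScheme

/-! ### The models -/

/-- Models in which the nodes do not know their neighbours: port assignment fixed (`IA`) or
free (`IB`). -/
inductive PortModel where
  | IA
  | IB

/-- When the network initially has port assignment `P₀`, the scheme may use `P`. -/
def PortModel.Allows {n : ℕ} {G : SimpleGraph (Fin n)} (P₀ P : PortAssignment G) :
    PortModel → Prop
  | .IA => P = P₀
  | .IB => True

/-- No relabeling (`α`), relabeling by a permutation (`β`), free relabeling (`γ`). -/
inductive LabelModel where
  | α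
  | β
  | γ

/-- The initial labels `1, …, n`, written in binary (least significant bit first). -/
def initialLabel {n : ℕ} (u : Fin n) : List Bool :=
  Nat.bits ((u : ℕ) + 1)

/-- The labelings that the scheme may use. -/
def LabelModel.Allows {n : ℕ} (l : Fin n → List Bool) : LabelModel → Prop
  | .α => l = initialLabel
  | .β => ∃ σ : Equiv.Perm (Fin n), l = fun u => initialLabel (σ u)
  | .γ => Function.Injective l

/-- The number of bits charged for a label: under free relabeling its length, otherwise nothing. -/
def LabelModel.labelCost (l : List Bool) : LabelModel → ℕ
  | .α => 0
  | .β => 0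
  | .γ => l.length

/-- The total number of bits needed to store the routing scheme. -/
def RoutingScheme.totalBits {n : ℕ} {G : SimpleGraph (Fin n)} (S : RoutingScheme G)
    (lm : LabelModel) : ℕ :=
  ∑ u : Fin n, ((S.stored u).length + lm.labelCost (S.label u))

/-! A message to a neighbour travels along the edge to it, so under shortest path routing each port
of a node `u` that receives some destination leads to a neighbour with the same port. Hence the
neighbours of `u` form a transversal of the fibres of the map from destinations to ports. The stored
strings, labels and degrees determine this map, and by `x ^ 3 ≤ 4 ^ x` it has at most `4 ^ (n / 3)`
transversals.

Given these data, `K` nodes leave only `4 ^ (K * n / 3)` instead of about `2 ^ (K * n - K ^ 2 / 2)`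
choices for their adjacencies. The saving is greatest at `K = n / 3`, where it is `n ^ 2 / 18` bits.
The graphs compatible with few bits of data can be enumerated given `n` and the allowed number of
bits, so each has complexity at most about the logarithm of their number. For a random graph the
bits of data must therefore make up for the saving, up to `O(δ(n) + n log n)`. -/

/-! ### Enumerating recursively enumerable families -/

section Enumeration

variable {α β : Type*} [Primcodable α] [Primcodable β]

theorem exists_primrec_approximation {f : α →. β} (hf : Partrec f) :
    ∃ g : ℕ → α → Option β, Primrec₂ g ∧
      (∀ {k l a b}, k ≤ l → b ∈ g k a → b ∈ g l a) ∧ ∀ a b, b ∈ f a ↔ ∃ k, b ∈ g k a := by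
  obtain ⟨c, hc⟩ := Nat.Partrec.Code.exists_code.1 hf
  refine ⟨fun k a => (c.evaln k (Encodable.encode a)).bind Encodable.decode, ?_, ?_, ?_⟩
  · have hevaln : Primrec fun q : ℕ × α => c.evaln q.1 (Encodable.encode q.2) :=
      Nat.Partrec.Code.primrec_evaln.comp
        ((Primrec.fst.pair (Primrec.const c)).pair (Primrec.encode.comp Primrec.snd))
    exact Primrec.option_bind hevaln (Primrec.decode.comp Primrec.snd)
  · intro k l a b hkl hb
    obtain ⟨m, hm, hmb⟩ := Option.mem_bind_iff.1 hb
    exact Option.mem_bind_iff.2 ⟨m, Nat.Partrec.Code.evaln_mono hkl hm, hmb⟩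
  · intro a b
    have hencode : b ∈ f a ↔ Encodable.encode b ∈ c.eval (Encodable.encode a) := by
      simp [hc]
    rw [hencode, Nat.Partrec.Code.evaln_complete]
    refine exists_congr fun k => ⟨fun h => Option.mem_bind_iff.2 ⟨_, h, by simp⟩, fun h => ?_⟩
    obtain ⟨m, hm, hmb⟩ := Option.mem_bind_iff.1 h
    obtain ⟨b', -, rfl⟩ : ∃ b' ∈ f a, Encodable.encode b' = m := by
      simpa [hc] using Nat.Partrec.Code.evaln_sound hm
    rw [Encodable.encodek, Option.mem_def, Option.some_inj] at hmb
    exact hmb ▸ hm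

theorem rePred_exists {p : α → β → Prop} (hp : PrimrecRel p) : REPred fun a => ∃ b, p a b := by
  classical
  have hsearch : Primrec₂ fun (a : α) (k : ℕ) =>
      (Encodable.decode (α := β) k).bind fun b => if p a b then some b else none :=
    Primrec.option_bind (Primrec.decode.comp Primrec.snd)
      (Primrec.ite (hp.comp (Primrec.fst.comp Primrec.fst) Primrec.snd)
        (Primrec.option_some.comp Primrec.snd) (Primrec.const none))
  refine (Partrec.rfindOpt hsearch.to_comp).dom_re.of_eq fun a => ?_
  rw [Nat.rfindOpt_dom]
  constructor
  · rintro ⟨k, b', h⟩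
    obtain ⟨b, -, hb⟩ := Option.mem_bind_iff.1 h
    exact ⟨b, by_contra fun hab => by simp [hab] at hb⟩
  · rintro ⟨b, h⟩
    exact ⟨Encodable.encode b, b, by simp [h]⟩

theorem exists_primrec_enumeration {p : α → β → Prop} (hp : REPred fun q : α × β => p q.1 q.2) :
    ∃ e : α → ℕ → Option β, Primrec₂ e ∧ ∀ a b, p a b ↔ ∃ j, e a j = some b := by
  obtain ⟨g, hg, -, hpg⟩ := exists_primrec_approximation hp
  refine ⟨fun a j => (Encodable.decode (α := β × ℕ) j).bind fun q =>
    (g q.2 (a, q.1)).map fun _ => q.1, ?_, fun a b => ?_⟩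
  · refine Primrec.option_bind (Primrec.decode.comp Primrec.snd) (Primrec.option_map ?_ ?_)
    · exact hg.comp (Primrec.snd.comp Primrec.snd)
        ((Primrec.fst.comp Primrec.fst).pair (Primrec.fst.comp Primrec.snd))
    · exact Primrec.fst.comp (Primrec.snd.comp Primrec.fst)
  · have hpab : p a b ↔ ∃ k, () ∈ g k (a, b) := by rw [← hpg]; simp
    rw [hpab]
    constructor
    · rintro ⟨k, hk⟩
      exact ⟨Encodable.encode (b, k), by simp [Option.mem_def.1 hk]⟩
    · rintro ⟨j, hj⟩
      obtain ⟨⟨b', k⟩, -, hb⟩ := Option.bind_eq_some_iff.1 hj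
      obtain ⟨_, hk, rfl⟩ := Option.map_eq_some_iff.1 hb
      exact ⟨k, hk⟩

end Enumeration

section DistinctValues

variable {β : Type*} [DecidableEq β]

/-- The values of the enumeration `e` before step `j`, in order of first occurrence: the place of a
value in this list does not change as `j` grows, and serves as its description. -/
def distinctValues (e : ℕ → Option β) : ℕ → List β
  | 0 => []
  | j + 1 => distinctValues e j ++ (e j).toList.filter (· ∉ distinctValues e j)

variable {e : ℕ → Option β}

theorem mem_distinctValues {j : ℕ} {x : β} : x ∈ distinctValues e j ↔ ∃ i < j, e i = some x := by
  induction j with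
  | zero => simp [distinctValues]
  | succ j ih =>
    by_cases hx : ∃ i < j, e i = some x
    · obtain ⟨i, hij, hi⟩ := hx
      exact iff_of_true (List.mem_append_left _ (ih.2 ⟨i, hij, hi⟩)) ⟨i, by lia, hi⟩
    · simp [distinctValues, ih, hx, le_iff_lt_or_eq, or_and_right, exists_or]

theorem nodup_distinctValues (e : ℕ → Option β) (j : ℕ) : (distinctValues e j).Nodup := by
  induction j with
  | zero => exact List.nodup_nil
  | succ j ih =>
    refine ih.append (List.Nodup.filter _ ?_) ?_
    · cases e j <;> simp
    · intro x hx hx'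
      simp [hx] at hx'

theorem distinctValues_prefix {i j : ℕ} (h : i ≤ j) :
    distinctValues e i <+: distinctValues e j := by
  induction j, h using Nat.le_induction with
  | base => exact List.prefix_rfl
  | succ j _ ih => exact ih.trans (List.prefix_append _ _)

theorem length_distinctValues_le {X : Set β} (hX : X.Finite) (he : ∀ i, ∀ x ∈ e i, x ∈ X) (j : ℕ) :
    (distinctValues e j).length ≤ X.ncard := by
  rw [← List.toFinset_card_of_nodup (nodup_distinctValues e j), ← Set.ncard_coe_finset]
  refine Set.ncard_le_ncard (fun x hx => ?_) hX
  obtain ⟨i, -, hi⟩ := mem_distinctValues.1 (List.mem_toFinset.1 hx)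
  exact he i x hi

end DistinctValues

theorem primrec_distinctValues {α β : Type*} [Primcodable α] [Primcodable β] [DecidableEq β]
    {e : α → ℕ → Option β} (he : Primrec₂ e) : Primrec₂ fun a => distinctValues (e a) := by
  have hnew : PrimrecRel fun (x : β) (l : List β) => x ∉ l := by
    refine PrimrecRel.not ((Primrec.eq.exists_mem_list (α := β)).swap.of_eq fun x l => ?_)
    simp
  have hstep : Primrec₂ fun (a : α) (q : ℕ × List β) =>
      q.2 ++ (e a q.1).toList.filter (· ∉ q.2) :=
    Primrec.list_append.comp (Primrec.snd.comp Primrec.snd)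
      (hnew.listFilter.comp (Primrec.optionToList.comp
        (he.comp Primrec.fst (Primrec.fst.comp Primrec.snd))) (Primrec.snd.comp Primrec.snd))
  refine (Primrec.nat_rec (Primrec.const []) hstep).of_eq fun a j => ?_
  induction j with
  | zero => rfl
  | succ j ih => simp only [distinctValues, ← ih]

/-- The number with binary digits `p`, least significant first: a left inverse of `Nat.bits`. -/
def natOfBits (p : List Bool) : ℕ :=
  p.foldr Nat.bit 0

theorem natOfBits_bits (n : ℕ) : natOfBits n.bits = n := by
  induction n using Nat.binaryRec' with
  | zero => simp [natOfBits]
  | bit b n h ih => rw [Nat.bits_append_bit n b h, natOfBits, List.foldr_cons, ← natOfBits, ih]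

theorem primrec_natOfBits : Primrec natOfBits := by
  have hbit : Primrec₂ Nat.bit :=
    (Primrec.cond Primrec.fst (Primrec.nat_double_succ.comp Primrec.snd)
      (Primrec.nat_double.comp Primrec.snd)).of_eq fun q => by cases q.1 <;> simp
  exact Primrec.list_foldr Primrec.id (Primrec.const 0)
    (hbit.comp₂ (Primrec.fst.comp₂ Primrec₂.right) (Primrec.snd.comp₂ Primrec₂.right))

/-! ### Describing the elements of small recursively enumerable sets -/

theorem exists_kolmogorovComplexity_le {U : List Bool × ℕ →. List Bool} (hU : IsUniversal U)
    {X : ℕ → Set (List Bool)} (hX : REPred fun q : ℕ × List Bool => q.2 ∈ X q.1) :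
    ∃ c : ℕ, ∀ y m : ℕ, (X y).Finite → (X y).ncard ≤ 2 ^ m →
      ∀ x ∈ X y, kolmogorovComplexity U x y ≤ m + c := by
  obtain ⟨e, he, hXe⟩ := exists_primrec_enumeration (p := fun y x => x ∈ X y) hX
  have hlookup : Primrec₂ fun (w : List Bool × ℕ) (j : ℕ) =>
      (distinctValues (e w.2) j)[natOfBits w.1]? :=
    Primrec.list_getElem?.comp
      ((primrec_distinctValues he).comp (Primrec.snd.comp Primrec.fst) Primrec.snd)
      (primrec_natOfBits.comp (Primrec.fst.comp Primrec.fst))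
  obtain ⟨c, hc⟩ := hU.2 _ (Partrec.rfindOpt hlookup.to_comp)
  refine ⟨c, fun y m hfin hcard x hx => ?_⟩
  obtain ⟨j, hj⟩ := (hXe y x).1 hx
  obtain ⟨i, hi, hix⟩ := List.mem_iff_getElem.1 (mem_distinctValues.2 ⟨j, j.lt_succ_self, hj⟩)
  have him : i < 2 ^ m := (hi.trans_le
    (length_distinctValues_le hfin (fun j z hz => (hXe y z).2 ⟨j, hz⟩) _)).trans_le hcard
  have hstable : ∀ {z k l}, k ≤ l → z ∈ (distinctValues (e y) k)[natOfBits i.bits]? →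
      z ∈ (distinctValues (e y) l)[natOfBits i.bits]? := fun hkl hz => by
    obtain ⟨hk, rfl⟩ := List.getElem?_eq_some_iff.1 hz
    rw [(distinctValues_prefix hkl).getElem hk]
    exact List.getElem?_eq_getElem _
  have hfound : x ∈ Nat.rfindOpt fun j => (distinctValues (e y) j)[natOfBits i.bits]? :=
    (Nat.rfindOpt_mono hstable).2 ⟨j + 1, by simp [natOfBits_bits, hi, hix]⟩
  obtain ⟨q, hq, hqU⟩ := hc i.bits y x hfound
  have hbits : i.bits.length ≤ m := by
    rw [Nat.size_eq_bits_len]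
    exact Nat.size_le.2 him
  calc kolmogorovComplexity U x y ≤ q.length := Nat.sInf_le ⟨q, rfl, hqU⟩
    _ ≤ i.bits.length + c := hq
    _ ≤ m + c := Nat.add_le_add_right hbits c

/-! ### Primitive recursive predicates on tables -/

/-- The entry in row `i` and column `j` of a table given as the list of its rows; outside the table
the entries have a default value. Tables encode functions of two nodes of a finite graph as data on
which a search can be run, uniformly in the number of nodes. -/
def entry {β : Type*} [Inhabited β] (t : List (List β)) (i j : ℕ) : β :=
  (t.getD i []).getD j default

theorem exists_entry_eq {β : Type*} [Inhabited β] {m n : ℕ} (f : Fin m → Fin n → β) :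
    ∃ t, ∀ (i : Fin m) (j : Fin n), entry t i j = f i j :=
  ⟨List.ofFn fun i => List.ofFn (f i), fun i j => by simp [entry]⟩

section Tables

variable {α : Type*} [Primcodable α]

theorem primrecPred_forall_fin {p : α × ℕ → Prop} {n : α → ℕ} (hp : PrimrecPred p)
    (hn : Primrec n) : PrimrecPred fun a => ∀ i : Fin (n a), p (a, i) :=
  ((PrimrecRel.forall_mem_list (R := fun i a => p (a, i))
    (hp.comp (Primrec.snd.pair Primrec.fst))).comp (Primrec.list_range.comp hn) Primrec.id).of_eq
      fun _ => by simp [Fin.forall_iff]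

theorem primrecPred_exists_fin {p : α × ℕ → Prop} {n : α → ℕ} (hp : PrimrecPred p)
    (hn : Primrec n) : PrimrecPred fun a => ∃ i : Fin (n a), p (a, i) :=
  ((PrimrecRel.exists_mem_list (R := fun i a => p (a, i))
    (hp.comp (Primrec.snd.pair Primrec.fst))).comp (Primrec.list_range.comp hn) Primrec.id).of_eq
      fun _ => by simp [Fin.exists_iff]

theorem primrecPred_imp {p q : α → Prop} (hp : PrimrecPred p) (hq : PrimrecPred q) :
    PrimrecPred fun a => p a → q a :=
  (hp.not.or hq).of_eq fun _ => imp_iff_not_or.symm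

theorem primrec_sum_fin {f : α → ℕ → ℕ} {n : α → ℕ} (hf : Primrec₂ f) (hn : Primrec n) :
    Primrec fun a => ∑ i : Fin (n a), f a i := by
  have hstep : Primrec₂ fun (a : α) (q : ℕ × ℕ) => q.2 + f a q.1 :=
    Primrec.nat_add.comp (Primrec.snd.comp Primrec.snd)
      (hf.comp Primrec.fst (Primrec.fst.comp Primrec.snd))
  refine (Primrec.nat_rec' hn (Primrec.const 0) hstep).of_eq fun a => ?_
  rw [Fin.sum_univ_eq_sum_range (f a)]
  induction n a with
  | zero => rfl
  | succ k ih => rw [Finset.sum_range_succ, ← ih]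

theorem primrec_entry {β : Type*} [Primcodable β] [Inhabited β] {t : α → List (List β)}
    {i j : α → ℕ} (ht : Primrec t) (hi : Primrec i) (hj : Primrec j) :
    Primrec fun a => entry (t a) (i a) (j a) :=
  (Primrec.list_getD default).comp ((Primrec.list_getD []).comp ht hi) hj

end Tables

/-- Adjacency as given by a table of bits: the bit of a pair is read in either order, so that every
table describes a graph. -/
def TableAdj (t : List (List Bool)) (i j : ℕ) : Prop :=
  i ≠ j ∧ (entry t i j = true ∨ entry t j i = true)

/-- The graph on `n` nodes described by a table of bits. -/
def tableGraph (n : ℕ) (t : List (List Bool)) : SimpleGraph (Fin n) where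
  Adj u v := TableAdj t u v
  symm := ⟨fun _ _ h => ⟨h.1.symm, h.2.symm⟩⟩
  loopless := ⟨fun _ h => h.1 rfl⟩

theorem tableGraph_surjective (n : ℕ) : Function.Surjective (tableGraph n) := by
  classical
  intro G
  obtain ⟨t, ht⟩ := exists_entry_eq fun u v => decide (G.Adj u v)
  refine ⟨t, ?_⟩
  ext u v
  simpa [tableGraph, TableAdj, ht, G.adj_comm v u, Fin.val_inj] using G.ne_of_adj

theorem primrecPred_tableAdj {α : Type*} [Primcodable α] {t : α → List (List Bool)}
    {i j : α → ℕ} (ht : Primrec t) (hi : Primrec i) (hj : Primrec j) :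
    PrimrecPred fun a => TableAdj (t a) (i a) (j a) :=
  (Primrec.eq.comp hi hj).not.and
    ((Primrec.eq.comp (primrec_entry ht hi hj) (Primrec.const true)).or
      (Primrec.eq.comp (primrec_entry ht hj hi) (Primrec.const true)))

theorem graphCode_tableGraph (n : ℕ) (t : List (List Bool)) :
    graphCode (tableGraph n t) = (List.range n).flatMap fun i =>
      ((List.range n).filter (i < ·)).map fun j => entry t i j || entry t j i := by
  rw [← List.map_coe_finRange_eq_range, List.flatMap_map]
  refine List.flatMap_congr fun u _ => ?_
  rw [List.filter_map, List.map_map]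
  refine List.map_congr_left fun v hv => ?_
  have huv : u < v := by simpa using (List.mem_filter.1 hv).2
  simp [tableGraph, TableAdj, Fin.val_inj, huv.ne]

theorem primrec_graphCode_tableGraph : Primrec₂ fun n t => graphCode (tableGraph n t) := by
  have hlist : Primrec fun q : ℕ × List (List Bool) => List.range q.1 :=
    Primrec.list_range.comp Primrec.fst
  have hbit : Primrec₂ fun (q : (ℕ × List (List Bool)) × ℕ) (j : ℕ) =>
      (entry q.1.2 q.2 j || entry q.1.2 j q.2) :=
    have ht := Primrec.snd.comp (Primrec.fst.comp Primrec.fst)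
    have hi := Primrec.snd.comp Primrec.fst
    Primrec.or.comp (primrec_entry ht hi Primrec.snd) (primrec_entry ht Primrec.snd hi)
  have hrow : Primrec₂ fun (q : ℕ × List (List Bool)) (i : ℕ) =>
      ((List.range q.1).filter (i < ·)).map fun j => entry q.2 i j || entry q.2 j i :=
    Primrec.list_map (Primrec.nat_lt.swap.listFilter.comp (hlist.comp Primrec.fst) Primrec.snd) hbit
  exact (Primrec.list_flatMap hlist hrow).of_eq fun q => (graphCode_tableGraph q.1 q.2).symm

/-! ### Graphs compatible with the data of a routing scheme -/

/-- `N` contains exactly one point of every nonempty fibre of `φ` on `s`. -/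
def IsTransversal {V P : Type*} (φ : V → P) (s N : Set V) : Prop :=
  N ⊆ s ∧ N.InjOn φ ∧ ∀ v ∈ s, ∃ w ∈ N, φ w = φ v

theorem IsTransversal.congr {V P : Type*} {φ ψ : V → P} {s N : Set V} (h : IsTransversal φ s N)
    (hφψ : s.EqOn φ ψ) : IsTransversal ψ s N := by
  obtain ⟨hsub, hinj, hsurj⟩ := h
  refine ⟨hsub, hinj.congr (hφψ.mono hsub), fun v hv => (hsurj v hv).imp fun w hw => ⟨hw.1, ?_⟩⟩
  rw [← hφψ (hsub hw.1), ← hφψ hv, hw.2]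

theorem isTransversal_neighborSet_iff {V P : Type*} {G : SimpleGraph V} {φ : V → P} {u : V} :
    IsTransversal φ {u}ᶜ (G.neighborSet u) ↔
      ∀ v, (∀ w, G.Adj u v → G.Adj u w → φ v = φ w → v = w) ∧
        (v ≠ u → ∃ w, G.Adj u w ∧ φ v = φ w) := by
  refine ⟨fun ⟨_, hinj, hsurj⟩ v => ⟨fun w hv hw h => hinj hv hw h, fun hv => ?_⟩,
    fun h => ⟨fun v hv => G.ne_of_adj hv.symm, fun v hv w hw hvw => (h v).1 w hv hw hvw,
      fun v hv => ?_⟩⟩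
  · exact (hsurj v hv).imp fun w hw => ⟨hw.1, hw.2.symm⟩
  · exact ((h v).2 hv).imp fun w hw => ⟨hw.1, hw.2.symm⟩

/-- What a scheme provides for one node: the stored string, the label and the degree. The degree is
recorded although it is not stored, because the routing language may use it. -/
abbrev NodeData : Type :=
  List Bool × List Bool × ℕ

/-- The input on which a node with data `d`, in a network of `n` nodes, selects the port for
messages to a node with data `e`. -/
def routerInput (n : ℕ) (d e : NodeData) : RouterInput :=
  ⟨d.1, d.2.1, d.2.2, n, e.2.1⟩

/-- The node data `D` select ports such that at every node the neighbours in `G` are a transversal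
for the ports selected for the other nodes. This is all that the counting uses of shortest path
routing. -/
def IsCompatible (R : RouterLanguage) {n : ℕ} (D : Fin n → NodeData) (G : SimpleGraph (Fin n)) :
    Prop :=
  ∃ φ : Fin n → Fin n → ℕ,
    (∀ u v, u ≠ v → φ u v ∈ R (routerInput n (D u) (D v))) ∧
      ∀ u, IsTransversal (φ u) {u}ᶜ (G.neighborSet u)

/-- The number of bits in the stored strings and labels. -/
def dataBits {n : ℕ} (D : Fin n → NodeData) : ℕ :=
  ∑ u, ((D u).1.length + (D u).2.1.length)

/-- The graphs on `n` nodes compatible with node data of at most `s` bits. -/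
def compactlyRouted (R : RouterLanguage) (n s : ℕ) : Set (SimpleGraph (Fin n)) :=
  {G | ∃ D, dataBits D ≤ s ∧ (∀ u, (D u).2.2 ≤ n) ∧ IsCompatible R D G}

theorem RouterLanguage.Effective.partrec_routerInput {R : RouterLanguage} (hR : R.Effective) :
    Partrec fun q : ℕ × NodeData × NodeData => R (routerInput q.1 q.2.1 q.2.2) := by
  have hd : Primrec fun q : ℕ × NodeData × NodeData => q.2.1 := Primrec.fst.comp Primrec.snd
  have he : Primrec fun q : ℕ × NodeData × NodeData => q.2.2 := Primrec.snd.comp Primrec.snd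
  exact hR.comp ((Primrec.fst.comp hd).pair ((Primrec.fst.comp (Primrec.snd.comp hd)).pair
    ((Primrec.snd.comp (Primrec.snd.comp hd)).pair
      (Primrec.fst.pair (Primrec.fst.comp (Primrec.snd.comp he)))))).to_comp

section Search

variable {α : Type*} [Primcodable α] {n : α → ℕ}

theorem primrecPred_isTransversal_table {a : α → List (List Bool)} {t : α → List (List ℕ)}
    (hn : Primrec n) (ha : Primrec a) (ht : Primrec t) :
    PrimrecPred fun z => ∀ u : Fin (n z), IsTransversal (fun v : Fin (n z) => entry (t z) u v)
      {u}ᶜ ((tableGraph (n z) (a z)).neighborSet u) := by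
  have hz : Primrec fun q : ((α × ℕ) × ℕ) × ℕ => q.1.1.1 :=
    Primrec.fst.comp (Primrec.fst.comp Primrec.fst)
  have hu : Primrec fun q : ((α × ℕ) × ℕ) × ℕ => q.1.1.2 :=
    Primrec.snd.comp (Primrec.fst.comp Primrec.fst)
  have hv : Primrec fun q : ((α × ℕ) × ℕ) × ℕ => q.1.2 := Primrec.snd.comp Primrec.fst
  have hw : Primrec fun q : ((α × ℕ) × ℕ) × ℕ => q.2 := Primrec.snd
  have hadj : PrimrecPred fun q : ((α × ℕ) × ℕ) × ℕ => TableAdj (a q.1.1.1) q.1.1.2 q.1.2 :=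
    primrecPred_tableAdj (ha.comp hz) hu hv
  have hadj' : PrimrecPred fun q : ((α × ℕ) × ℕ) × ℕ => TableAdj (a q.1.1.1) q.1.1.2 q.2 :=
    primrecPred_tableAdj (ha.comp hz) hu hw
  have heq : PrimrecPred fun q : ((α × ℕ) × ℕ) × ℕ =>
      entry (t q.1.1.1) q.1.1.2 q.1.2 = entry (t q.1.1.1) q.1.1.2 q.2 :=
    Primrec.eq.comp (primrec_entry (ht.comp hz) hu hv) (primrec_entry (ht.comp hz) hu hw)
  have hinj : PrimrecPred fun q : (α × ℕ) × ℕ => ∀ w : Fin (n q.1.1),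
      TableAdj (a q.1.1) q.1.2 q.2 → TableAdj (a q.1.1) q.1.2 w →
        entry (t q.1.1) q.1.2 q.2 = entry (t q.1.1) q.1.2 w → q.2 = w :=
    primrecPred_forall_fin (primrecPred_imp hadj (primrecPred_imp hadj' (primrecPred_imp heq
      (Primrec.eq.comp hv hw)))) (hn.comp (Primrec.fst.comp Primrec.fst))
  have hsurj : PrimrecPred fun q : (α × ℕ) × ℕ => q.2 ≠ q.1.2 → ∃ w : Fin (n q.1.1),
      TableAdj (a q.1.1) q.1.2 w ∧ entry (t q.1.1) q.1.2 q.2 = entry (t q.1.1) q.1.2 w :=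
    primrecPred_imp (Primrec.eq.comp Primrec.snd (Primrec.snd.comp Primrec.fst)).not
      (primrecPred_exists_fin (hadj'.and heq) (hn.comp (Primrec.fst.comp Primrec.fst)))
  refine (primrecPred_forall_fin (primrecPred_forall_fin (hinj.and hsurj)
    (hn.comp Primrec.fst)) hn).of_eq fun z => ?_
  simp only [isTransversal_neighborSet_iff, ne_eq, Fin.ext_iff]
  rfl

theorem primrecPred_mem_router_table {g : ℕ → ℕ × NodeData × NodeData → Option ℕ}
    {d : α → List NodeData} {t : α → List (List ℕ)} {k : α → ℕ} (hg : Primrec₂ g) (hn : Primrec n)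
    (hd : Primrec d) (ht : Primrec t) (hk : Primrec k) :
    PrimrecPred fun z => ∀ u v : Fin (n z), u ≠ v →
      entry (t z) u v ∈ g (k z) (n z, (d z).getD u default, (d z).getD v default) := by
  have hz : Primrec fun q : (α × ℕ) × ℕ => q.1.1 := Primrec.fst.comp Primrec.fst
  have hu : Primrec fun q : (α × ℕ) × ℕ => q.1.2 := Primrec.snd.comp Primrec.fst
  have hnode : Primrec fun q : α × ℕ => (d q.1).getD q.2 default :=
    (Primrec.list_getD default).comp (hd.comp Primrec.fst) Primrec.snd
  have hport : PrimrecPred fun q : (α × ℕ) × ℕ => q.1.2 ≠ q.2 →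
      g (k q.1.1) (n q.1.1, (d q.1.1).getD q.1.2 default, (d q.1.1).getD q.2 default) =
        some (entry (t q.1.1) q.1.2 q.2) :=
    primrecPred_imp (Primrec.eq.comp hu Primrec.snd).not <| Primrec.eq.comp
      (hg.comp (hk.comp hz) ((hn.comp hz).pair
        ((hnode.comp (hz.pair hu)).pair (hnode.comp (hz.pair Primrec.snd)))))
      (Primrec.option_some.comp (primrec_entry (ht.comp hz) hu Primrec.snd))
  refine (primrecPred_forall_fin (primrecPred_forall_fin hport (hn.comp Primrec.fst)) hn).of_eq
    fun z => ?_
  simp only [Option.mem_def, ne_eq, Fin.val_inj]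

theorem primrecPred_dataBits_list {d : α → List NodeData} {s : α → ℕ} (hn : Primrec n)
    (hd : Primrec d) (hs : Primrec s) :
    PrimrecPred fun z => dataBits (fun u : Fin (n z) => (d z).getD u default) ≤ s z ∧
      ∀ u : Fin (n z), ((d z).getD u default).2.2 ≤ n z := by
  have hnode : Primrec fun q : α × ℕ => (d q.1).getD q.2 default :=
    (Primrec.list_getD default).comp (hd.comp Primrec.fst) Primrec.snd
  have hbits : Primrec₂ fun (z : α) (u : ℕ) =>
      ((d z).getD u default).1.length + ((d z).getD u default).2.1.length :=
    Primrec.nat_add.comp (Primrec.list_length.comp (Primrec.fst.comp hnode))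
      (Primrec.list_length.comp (Primrec.fst.comp (Primrec.snd.comp hnode)))
  exact (Primrec.nat_le.comp (primrec_sum_fin hbits hn) hs).and <|
    primrecPred_forall_fin (
      Primrec.nat_le.comp (Primrec.snd.comp (Primrec.snd.comp hnode)) (hn.comp Primrec.fst)) hn

end Search

/-- Tables of the adjacency, of the node data and of the selected ports, and a number of steps. -/
abbrev RoutingWitness : Type :=
  List (List Bool) × List NodeData × List (List ℕ) × ℕ

/-- `w` shows that its graph belongs to `compactlyRouted R n s`, where `g` approximates the routing
language `R`: the number of steps of `w` suffices for `g` to produce all the ports. -/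
def IsRoutingWitness (g : ℕ → ℕ × NodeData × NodeData → Option ℕ) (n s : ℕ)
    (w : RoutingWitness) : Prop :=
  (dataBits (fun u : Fin n => w.2.1.getD u default) ≤ s ∧
      ∀ u : Fin n, (w.2.1.getD u default).2.2 ≤ n) ∧
    (∀ u v : Fin n, u ≠ v →
      entry w.2.2.1 u v ∈ g w.2.2.2 (n, w.2.1.getD u default, w.2.1.getD v default)) ∧
    ∀ u : Fin n, IsTransversal (fun v : Fin n => entry w.2.2.1 u v) {u}ᶜ
      ((tableGraph n w.1).neighborSet u)

theorem mem_compactlyRouted_iff {R : RouterLanguage}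
    {g : ℕ → ℕ × NodeData × NodeData → Option ℕ}
    (hmono : ∀ {k l q p}, k ≤ l → p ∈ g k q → p ∈ g l q)
    (hgR : ∀ q p, p ∈ R (routerInput q.1 q.2.1 q.2.2) ↔ ∃ k, p ∈ g k q) {n s : ℕ}
    {G : SimpleGraph (Fin n)} :
    G ∈ compactlyRouted R n s ↔ ∃ w, tableGraph n w.1 = G ∧ IsRoutingWitness g n s w := by
  constructor
  · rintro ⟨D, hbits, hdeg, φ, hφ, htrans⟩
    obtain ⟨a, rfl⟩ := tableGraph_surjective n G
    obtain ⟨t, ht⟩ := exists_entry_eq φ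
    have hD : ∀ u : Fin n, (List.ofFn D).getD u default = D u := by simp
    have hsteps : ∀ u v, u ≠ v → ∀ᶠ k in atTop, φ u v ∈ g k (n, D u, D v) := fun u v huv =>
      have ⟨k, hk⟩ := (hgR (n, D u, D v) _).1 (hφ u v huv)
      eventually_atTop.2 ⟨k, fun l hl => hmono hl hk⟩
    obtain ⟨k, hk⟩ : ∃ k, ∀ u v, u ≠ v → φ u v ∈ g k (n, D u, D v) :=
      (eventually_all.2 fun u => eventually_all.2 fun v => eventually_imp_distrib_left.2
        (hsteps u v)).exists
    refine ⟨(a, List.ofFn D, t, k), rfl, ?_⟩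
    simp only [IsRoutingWitness, hD, ht]
    exact ⟨⟨hbits, hdeg⟩, hk, htrans⟩
  · rintro ⟨w, rfl, ⟨hbits, hdeg⟩, hports, htrans⟩
    exact ⟨_, hbits, hdeg, _, fun u v huv => (hgR (_, _, _) _).2 ⟨_, hports u v huv⟩, htrans⟩

theorem primrecPred_isRoutingWitness {α : Type*} [Primcodable α]
    {g : ℕ → ℕ × NodeData × NodeData → Option ℕ} {n s : α → ℕ} {w : α → RoutingWitness}
    (hg : Primrec₂ g) (hn : Primrec n) (hs : Primrec s) (hw : Primrec w) :
    PrimrecPred fun z => IsRoutingWitness g (n z) (s z) (w z) := by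
  have ha : Primrec fun z => (w z).1 := Primrec.fst.comp hw
  have hd : Primrec fun z => (w z).2.1 := Primrec.fst.comp (Primrec.snd.comp hw)
  have htk : Primrec fun z => (w z).2.2 := Primrec.snd.comp (Primrec.snd.comp hw)
  exact (primrecPred_dataBits_list hn hd hs).and <|
    (primrecPred_mem_router_table hg hn hd (Primrec.fst.comp htk) (Primrec.snd.comp htk)).and
      (primrecPred_isTransversal_table hn ha (Primrec.fst.comp htk))

theorem rePred_mem_graphCode_compactlyRouted {R : RouterLanguage} (hR : R.Effective) {n s : ℕ → ℕ}
    (hn : Primrec n) (hs : Primrec s) :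
    REPred fun q : ℕ × List Bool => q.2 ∈ graphCode '' compactlyRouted R (n q.1) (s q.1) := by
  obtain ⟨g, hg, hmono, hgR⟩ := exists_primrec_approximation hR.partrec_routerInput
  have hy : Primrec fun z : (ℕ × List Bool) × RoutingWitness => z.1.1 :=
    Primrec.fst.comp Primrec.fst
  have hsearch : PrimrecRel fun (q : ℕ × List Bool) (w : RoutingWitness) =>
      IsRoutingWitness g (n q.1) (s q.1) w ∧ graphCode (tableGraph (n q.1) w.1) = q.2 :=
    (primrecPred_isRoutingWitness hg (hn.comp hy) (hs.comp hy) Primrec.snd).and <|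
      Primrec.eq.comp
        (primrec_graphCode_tableGraph.comp (hn.comp hy) (Primrec.fst.comp Primrec.snd))
        (Primrec.snd.comp Primrec.fst)
  refine (rePred_exists hsearch).of_eq fun q => ?_
  simp only [Set.mem_image, mem_compactlyRouted_iff (R := R) (g := g) hmono hgR]
  constructor
  · rintro ⟨w, hw, hcode⟩
    exact ⟨_, ⟨w, rfl, hw⟩, hcode⟩
  · rintro ⟨_, ⟨w, rfl, hw⟩, hcode⟩
    exact ⟨w, hw, hcode⟩

/-! ### Shortest path routing schemes -/

namespace RoutingScheme

variable {R : RouterLanguage} {n : ℕ} {G : SimpleGraph (Fin n)} {S : RoutingScheme G}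

/-- The stored string, the label and the degree of each node. -/
noncomputable def nodeData (S : RoutingScheme G) (u : Fin n) : NodeData :=
  (S.stored u, S.label u, nodeDegree G u)

theorem IsShortestPath.exists_port (hS : S.IsShortestPath R) {u v : Fin n} (huv : u ≠ v) :
    ∃ p ∈ R (routerInput n (S.nodeData u) (S.nodeData v)),
      ∃ hp : p ∈ Set.Icc 1 (nodeDegree G u), G.Adj u v → (S.port u ⟨p, hp⟩ : Fin n) = v := by
  obtain ⟨q, hq, hlen⟩ := hS u v
  cases q with
  | nil => exact absurd rfl huv
  | @cons _ w _ _ q =>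
    obtain ⟨⟨p, hp, hpw⟩, -⟩ := hq
    refine ⟨p, hp, p.2, fun hadj => hpw.trans ?_⟩
    rw [SimpleGraph.dist_eq_one_iff_adj.2 hadj, SimpleGraph.Walk.length_cons] at hlen
    exact SimpleGraph.Walk.eq_of_length_eq_zero (Nat.succ.inj hlen)

theorem IsShortestPath.isCompatible (hS : S.IsShortestPath R) : IsCompatible R S.nodeData G := by
  choose! p hp hdeg hadj using fun u v (huv : u ≠ v) => hS.exists_port huv
  refine ⟨p, hp, fun u => isTransversal_neighborSet_iff.2 fun v => ⟨?_, ?_⟩⟩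
  · intro w hv hw hvw
    rw [← hadj u v hv.ne hv, ← hadj u w hw.ne hw]
    simp only [hvw]
  · intro hvu
    let i : Set.Icc 1 (nodeDegree G u) := ⟨p u v, hdeg u v hvu.symm⟩
    have hw : G.Adj u (S.port u i) := (S.port u i).2
    have hport : i = ⟨p u (S.port u i), hdeg u _ hw.ne⟩ :=
      (S.port u).injective (Subtype.ext (hadj u _ hw.ne hw).symm)
    exact ⟨_, hw, congrArg Subtype.val hport⟩

end RoutingScheme

/-! ### Counting -/

theorem cube_le_four_pow (x : ℕ) : x ^ 3 ≤ 4 ^ x := by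
  match x with
  | 0 | 1 => norm_num
  | x + 2 =>
    induction x with
    | zero => norm_num
    | succ x ih =>
      calc (x + 1 + 2) ^ 3 ≤ 4 * (x + 2) ^ 3 := by ring_nf; nlinarith
        _ ≤ 4 * 4 ^ (x + 2) := Nat.mul_le_mul_left 4 ih
        _ = 4 ^ (x + 1 + 2) := by ring

theorem prod_card_fiber_cube_le {V P : Type*} [DecidableEq P] (φ : V → P) (s : Finset V) :
    (∏ p ∈ s.image φ, (s.filter (φ · = p)).card) ^ 3 ≤ 4 ^ s.card := by
  rw [Finset.card_eq_sum_card_image φ s, ← Finset.prod_pow_eq_pow_sum, ← Finset.prod_pow]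
  exact Finset.prod_le_prod' fun p _ => cube_le_four_pow _

theorem ncard_isTransversal_le {V P : Type*} [DecidableEq P] (φ : V → P) (s : Finset V) :
    {N | IsTransversal φ s N}.ncard ≤ ∏ p ∈ s.image φ, (s.filter (φ · = p)).card := by
  let choices := (s.image φ).pi fun p => s.filter (φ · = p)
  let values (c : ∀ p ∈ s.image φ, V) : Set V := {v | ∃ p hp, c p hp = v}
  have hcover : {N | IsTransversal φ s N} ⊆ values '' (choices : Set (∀ p ∈ s.image φ, V)) := by
    rintro N ⟨hsub, hinj, hsurj⟩
    have hex : ∀ p ∈ s.image φ, ∃ w ∈ N, φ w = p := fun p hp => by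
      obtain ⟨v, hv, rfl⟩ := Finset.mem_image.1 hp
      exact hsurj v hv
    choose c hcN hcφ using hex
    refine ⟨c, ?_, Set.Subset.antisymm ?_ fun v hv => ?_⟩
    · exact Finset.mem_pi.2 fun p hp => Finset.mem_filter.2 ⟨hsub (hcN p hp), hcφ p hp⟩
    · rintro _ ⟨p, hp, rfl⟩
      exact hcN p hp
    · have hp : φ v ∈ s.image φ := Finset.mem_image_of_mem φ (hsub hv)
      exact ⟨φ v, hp, hinj (hcN _ hp) hv (hcφ _ hp)⟩
  calc {N | IsTransversal φ s N}.ncard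
      ≤ (values '' (choices : Set (∀ p ∈ s.image φ, V))).ncard :=
        Set.ncard_le_ncard hcover (choices.finite_toSet.image _)
    _ ≤ choices.card := (Set.ncard_image_le choices.finite_toSet).trans_eq (Set.ncard_coe_finset _)
    _ = _ := Finset.card_pi _ _

theorem natCard_simpleGraph_le (V : Type*) [Fintype V] :
    Nat.card (SimpleGraph V) ≤ 2 ^ (Fintype.card V).choose 2 := by
  classical
  have hinj : Function.Injective fun (G : SimpleGraph V) =>
      ({e | (e : Sym2 V) ∈ G.edgeSet} : Set {e : Sym2 V // ¬ e.IsDiag}) := by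
    intro G H h
    refine SimpleGraph.edgeSet_injective (Set.ext fun e => ?_)
    by_cases he : e.IsDiag
    · exact iff_of_false (fun h => G.not_isDiag_of_mem_edgeSet h he)
        (fun h => H.not_isDiag_of_mem_edgeSet h he)
    · exact Set.ext_iff.1 h ⟨e, he⟩
  refine (Nat.card_le_card_of_injective _ hinj).trans ?_
  rw [Nat.card_eq_fintype_card, Fintype.card_set, Sym2.card_subtype_not_diag]

theorem ncard_neighborSet_mem_le {V : Type*} [Fintype V] (S : Finset V)
    (𝒩 : V → Set (Set V)) :
    {G : SimpleGraph V | ∀ u ∈ S, G.neighborSet u ∈ 𝒩 u}.ncard ≤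
      (∏ u ∈ S, (𝒩 u).ncard) * 2 ^ (Fintype.card V - S.card).choose 2 := by
  classical
  let parts (G : {G : SimpleGraph V // ∀ u ∈ S, G.neighborSet u ∈ 𝒩 u}) :
      (∀ u : S, 𝒩 u) × SimpleGraph {u // u ∉ S} :=
    (fun u => ⟨G.1.neighborSet u, G.2 u u.2⟩, G.1.comap Subtype.val)
  have hinj : Function.Injective parts := by
    rintro ⟨G, hG⟩ ⟨H, hH⟩ h
    have hnbr : ∀ u ∈ S, ∀ v, G.Adj u v ↔ H.Adj u v := fun u hu v =>
      Set.ext_iff.1 (congrArg Subtype.val (congrFun (congrArg Prod.fst h) ⟨u, hu⟩)) v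
    ext u v
    by_cases hu : u ∈ S
    · exact hnbr u hu v
    by_cases hv : v ∈ S
    · rw [G.adj_comm, H.adj_comm]
      exact hnbr v hv u
    · exact iff_of_eq (congrFun₂ (congrArg SimpleGraph.Adj (congrArg Prod.snd h)) ⟨u, hu⟩ ⟨v, hv⟩)
  rw [← Nat.card_coe_set_eq]
  refine (Nat.card_le_card_of_injective parts hinj).trans ?_
  rw [Nat.card_prod, Nat.card_pi, Finset.prod_coe_sort S fun u => Nat.card (𝒩 u)]
  have hcard : Fintype.card {u // u ∉ S} = Fintype.card V - S.card := by
    simp [Fintype.card_subtype_compl]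
  exact Nat.mul_le_mul_left _ (hcard ▸ natCard_simpleGraph_le _)

theorem ncard_isCompatible_le (R : RouterLanguage) {n k : ℕ} (hk : 3 * k ≤ n)
    (D : Fin n → NodeData) :
    {G | IsCompatible R D G}.ncard ≤ 4 ^ (n * k) * 2 ^ (n - 3 * k).choose 2 := by
  obtain hempty | ⟨G₀, φ, hφ, -⟩ := {G | IsCompatible R D G}.eq_empty_or_nonempty
  · simp [hempty]
  obtain ⟨S, -, hS⟩ := Finset.exists_subset_card_eq (s := (Finset.univ : Finset (Fin n)))
    (n := 3 * k) (by simpa using hk)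
  let 𝒩 (u : Fin n) : Set (Set (Fin n)) := {N | IsTransversal (φ u) ({u}ᶜ : Finset (Fin n)) N}
  have hcompat : {G | IsCompatible R D G} ⊆ {G | ∀ u ∈ S, G.neighborSet u ∈ 𝒩 u} := by
    rintro G ⟨ψ, hψ, htrans⟩ u -
    simpa [𝒩] using (htrans u).congr fun v hv =>
      Part.mem_unique (hψ u v (Ne.symm hv)) (hφ u v (Ne.symm hv))
  have hnode : ∀ u, (𝒩 u).ncard ^ 3 ≤ 4 ^ n := fun u =>
    calc (𝒩 u).ncard ^ 3 ≤ _ := Nat.pow_le_pow_left (ncard_isTransversal_le _ _) 3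
      _ ≤ 4 ^ ({u}ᶜ : Finset (Fin n)).card := prod_card_fiber_cube_le _ _
      _ ≤ 4 ^ n := Nat.pow_le_pow_right (by norm_num) (by simp [Finset.card_compl])
  have hprod : ∏ u ∈ S, (𝒩 u).ncard ≤ 4 ^ (n * k) := by
    refine (Nat.pow_le_pow_iff_left three_ne_zero).1 ?_
    calc (∏ u ∈ S, (𝒩 u).ncard) ^ 3 = ∏ u ∈ S, (𝒩 u).ncard ^ 3 := (Finset.prod_pow _ _ _).symm
      _ ≤ (4 ^ n) ^ S.card := Finset.prod_le_pow_card _ _ _ fun u _ => hnode u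
      _ = (4 ^ (n * k)) ^ 3 := by rw [hS]; ring
  calc {G | IsCompatible R D G}.ncard
      ≤ {G : SimpleGraph (Fin n) | ∀ u ∈ S, G.neighborSet u ∈ 𝒩 u}.ncard :=
        Set.ncard_le_ncard hcompat (Set.toFinite _)
    _ ≤ (∏ u ∈ S, (𝒩 u).ncard) * 2 ^ (n - 3 * k).choose 2 := by
        simpa [hS] using ncard_neighborSet_mem_le S 𝒩
    _ ≤ _ := Nat.mul_le_mul_right _ hprod

/-- The binary strings of length at most `s`. -/
def stringsUpTo : ℕ → Finset (List Bool)
  | 0 => {[]}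
  | s + 1 => insert [] ((Finset.univ ×ˢ stringsUpTo s).image fun p => p.1 :: p.2)

theorem mem_stringsUpTo {s : ℕ} {x : List Bool} (h : x.length ≤ s) : x ∈ stringsUpTo s := by
  induction s generalizing x with
  | zero => simpa [stringsUpTo] using h
  | succ s ih =>
    cases x with
    | nil => simp [stringsUpTo]
    | cons b x => simp [stringsUpTo, ih (Nat.le_of_succ_le_succ h)]

theorem sum_stringsUpTo_half_pow_length (s : ℕ) :
    ∑ x ∈ stringsUpTo s, (1 / 2 : ℚ) ^ x.length = s + 1 := by
  induction s with
  | zero => simp [stringsUpTo]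
  | succ s ih =>
    have hinj : Set.InjOn (fun p : Bool × List Bool => p.1 :: p.2)
        (Finset.univ ×ˢ stringsUpTo s : Finset (Bool × List Bool)) := by
      rintro ⟨a, x⟩ - ⟨b, y⟩ - h
      simpa using h
    rw [stringsUpTo, Finset.sum_insert (by simp), Finset.sum_image hinj, Finset.sum_product]
    simp only [List.length_nil, pow_zero, List.length_cons, pow_succ, ← Finset.sum_mul, ih,
      Finset.sum_const, Finset.card_univ, Fintype.card_bool]
    push_cast
    ring

theorem card_filter_sum_le_two_pow_mul {ι α : Type*} [Fintype ι] [DecidableEq ι] (t : Finset α)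
    (ℓ : α → ℕ) (s : ℕ) :
    ({D ∈ Fintype.piFinset fun _ : ι => t | ∑ i, ℓ (D i) ≤ s}.card : ℚ) ≤
      2 ^ s * (∑ a ∈ t, (1 / 2 : ℚ) ^ ℓ a) ^ Fintype.card ι := by
  calc ({D ∈ Fintype.piFinset fun _ : ι => t | ∑ i, ℓ (D i) ≤ s}.card : ℚ)
      = ∑ D ∈ Fintype.piFinset fun _ : ι => t with ∑ i, ℓ (D i) ≤ s, 1 := by simp
    _ ≤ ∑ D ∈ Fintype.piFinset fun _ : ι => t with ∑ i, ℓ (D i) ≤ s,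
          2 ^ s * (1 / 2) ^ ∑ i, ℓ (D i) := by
        refine Finset.sum_le_sum fun D hD => ?_
        rw [one_div, inv_pow, ← div_eq_mul_inv, one_le_div (by positivity)]
        exact pow_le_pow_right₀ one_le_two (Finset.mem_filter.1 hD).2
    _ ≤ ∑ D ∈ Fintype.piFinset fun _ : ι => t, 2 ^ s * (1 / 2) ^ ∑ i, ℓ (D i) :=
        Finset.sum_le_sum_of_subset_of_nonneg (Finset.filter_subset _ _)
          fun D _ _ => by positivity
    _ = 2 ^ s * ∏ _i : ι, ∑ a ∈ t, (1 / 2) ^ ℓ a := by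
        simp only [← Finset.mul_sum, ← Finset.prod_pow_eq_pow_sum, Finset.prod_univ_sum]
    _ = _ := by rw [Finset.prod_const, Finset.card_univ]

/-- The families of node data of at most `s` bits on `n` nodes with degrees at most `n`. -/
def dataFamilies (n s : ℕ) : Finset (Fin n → NodeData) :=
  {D ∈ Fintype.piFinset fun _ => stringsUpTo s ×ˢ stringsUpTo s ×ˢ Finset.range (n + 1) |
    dataBits D ≤ s}

theorem mem_dataFamilies {n s : ℕ} {D : Fin n → NodeData} (hbits : dataBits D ≤ s)
    (hdeg : ∀ u, (D u).2.2 ≤ n) : D ∈ dataFamilies n s := by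
  have hnode (u : Fin n) : (D u).1.length + (D u).2.1.length ≤ s :=
    (Finset.single_le_sum (f := fun u => (D u).1.length + (D u).2.1.length)
      (fun _ _ => Nat.zero_le _) (Finset.mem_univ u)).trans hbits
  refine Finset.mem_filter.2 ⟨Fintype.mem_piFinset.2 fun u => ?_, hbits⟩
  exact Finset.mem_product.2 ⟨mem_stringsUpTo (le_of_add_le_left (hnode u)),
    Finset.mem_product.2 ⟨mem_stringsUpTo (le_of_add_le_right (hnode u)),
      Finset.mem_range_succ_iff.2 (hdeg u)⟩⟩

theorem card_dataFamilies_le (n s : ℕ) :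
    (dataFamilies n s).card ≤ 2 ^ s * ((s + 1) ^ 2 * (n + 1)) ^ n := by
  have hweight : ∑ d ∈ stringsUpTo s ×ˢ stringsUpTo s ×ˢ Finset.range (n + 1),
      (1 / 2 : ℚ) ^ (d.1.length + d.2.1.length) = (s + 1) ^ 2 * (n + 1) := by
    simp only [Finset.sum_product, pow_add, ← Finset.mul_sum, Finset.sum_const, ← Finset.sum_mul,
      sum_stringsUpTo_half_pow_length, Finset.card_range, nsmul_eq_mul]
    push_cast
    ring
  have hcard := card_filter_sum_le_two_pow_mul (ι := Fin n)
    (stringsUpTo s ×ˢ stringsUpTo s ×ˢ Finset.range (n + 1))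
    (fun d : NodeData => d.1.length + d.2.1.length) s
  rw [hweight, Fintype.card_fin] at hcard
  exact_mod_cast hcard

theorem card_dataFamilies_le_two_pow {n s : ℕ} (hs : s ≤ n ^ 2) :
    (dataFamilies n s).card ≤ 2 ^ (s + 5 * (n * n.size)) := by
  have hn : n + 1 ≤ 2 ^ n.size := Nat.lt_size_self n
  have hnode : (s + 1) ^ 2 * (n + 1) ≤ 2 ^ (5 * n.size) :=
    calc (s + 1) ^ 2 * (n + 1) ≤ ((n + 1) ^ 2) ^ 2 * (n + 1) := by gcongr; nlinarith
      _ = (n + 1) ^ 5 := by ring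
      _ ≤ (2 ^ n.size) ^ 5 := Nat.pow_le_pow_left hn 5
      _ = 2 ^ (5 * n.size) := by rw [← pow_mul, mul_comm]
  calc (dataFamilies n s).card ≤ 2 ^ s * ((s + 1) ^ 2 * (n + 1)) ^ n := card_dataFamilies_le n s
    _ ≤ 2 ^ s * (2 ^ (5 * n.size)) ^ n := by gcongr
    _ = 2 ^ (s + 5 * (n * n.size)) := by rw [← pow_mul, ← pow_add]; ring_nf

/-- The number of bits by which the logarithm of the number of graphs on `n` nodes compatible with
some node data of `s` bits may exceed `s`. The choice of `3 * (n / 9)` nodes, a third of all, at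
which the neighbourhoods are counted minimizes the terms of order `n ^ 2`. -/
def excessBits (n : ℕ) : ℕ :=
  5 * (n * n.size) + 2 * (n * (n / 9)) + (n - 3 * (n / 9)).choose 2

theorem ncard_compactlyRouted_le (R : RouterLanguage) {n s : ℕ} (hs : s ≤ n ^ 2) :
    (compactlyRouted R n s).ncard ≤ 2 ^ (s + excessBits n) := by
  have hcover : compactlyRouted R n s ⊆ ⋃ D ∈ dataFamilies n s, {G | IsCompatible R D G} := by
    rintro G ⟨D, hbits, hdeg, hG⟩
    exact Set.mem_biUnion (mem_dataFamilies hbits hdeg) hG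
  calc (compactlyRouted R n s).ncard
      ≤ (⋃ D ∈ dataFamilies n s, {G | IsCompatible R D G}).ncard :=
        Set.ncard_le_ncard hcover (Set.toFinite _)
    _ ≤ ∑ D ∈ dataFamilies n s, {G | IsCompatible R D G}.ncard := Finset.set_ncard_biUnion_le _ _
    _ ≤ (dataFamilies n s).card * (4 ^ (n * (n / 9)) * 2 ^ (n - 3 * (n / 9)).choose 2) :=
        Finset.sum_le_card_nsmul _ _ _ fun D _ => ncard_isCompatible_le R (by omega) D
    _ ≤ 2 ^ (s + 5 * (n * n.size)) *
          (4 ^ (n * (n / 9)) * 2 ^ (n - 3 * (n / 9)).choose 2) :=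
        Nat.mul_le_mul_right _ (card_dataFamilies_le_two_pow hs)
    _ = 2 ^ (s + excessBits n) := by
        rw [show 4 = 2 ^ 2 from rfl, ← pow_mul, ← pow_add, ← pow_add, excessBits]
        ring_nf

/-! ### The complexity of graphs with short routing data -/

theorem primrec_pow : Primrec₂ ((· ^ ·) : ℕ → ℕ → ℕ) :=
  Primrec₂.unpaired'.1 Nat.Primrec.pow

theorem primrec_size : Primrec Nat.size := by
  have hle : PrimrecRel fun n k : ℕ => 2 ^ k ≤ 2 * n :=
    Primrec.nat_le.comp (primrec_pow.comp (Primrec.const 2) Primrec.snd)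
      (Primrec.nat_mul.comp (Primrec.const 2) Primrec.fst)
  have hsize (n k : ℕ) : 2 ^ (k + 1) ≤ 2 * n ↔ k + 1 ≤ n.size := by
    rw [pow_succ', Nat.mul_le_mul_left_iff two_pos, ← Nat.lt_size, Nat.succ_le_iff]
  refine (Primrec.nat_findGreatest Primrec.id hle).of_eq fun n => ?_
  refine Nat.findGreatest_eq_iff.2 ⟨Nat.size_le.2 Nat.lt_two_pow_self, fun h => ?_, ?_⟩
  · obtain ⟨k, hk⟩ := Nat.exists_eq_succ_of_ne_zero h
    rw [hk]
    exact (hsize n k).2 hk.ge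
  · rintro (_ | k) hlt - hle
    · exact absurd hlt (Nat.not_lt_zero _)
    · exact absurd ((hsize n k).1 hle) (not_le.2 hlt)

theorem primrec_choose_two : Primrec fun n : ℕ => n.choose 2 :=
  (Primrec.nat_div.comp (Primrec.nat_mul.comp Primrec.id (Primrec.nat_sub.comp Primrec.id
    (Primrec.const 1))) (Primrec.const 2)).of_eq fun n => (Nat.choose_two_right n).symm

theorem primrec_excessBits : Primrec excessBits := by
  have hdiv : Primrec fun n : ℕ => n / 9 := Primrec.nat_div.comp Primrec.id (Primrec.const 9)
  refine Primrec.nat_add.comp (Primrec.nat_add.comp ?_ ?_) ?_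
  · exact Primrec.nat_mul.comp (Primrec.const 5) (Primrec.nat_mul.comp Primrec.id primrec_size)
  · exact Primrec.nat_mul.comp (Primrec.const 2) (Primrec.nat_mul.comp Primrec.id hdiv)
  · exact primrec_choose_two.comp (Primrec.nat_sub.comp Primrec.id
      (Primrec.nat_mul.comp (Primrec.const 3) hdiv))

theorem exists_kolmogorovComplexity_graphCode_le {U : List Bool × ℕ →. List Bool}
    (hU : IsUniversal U) {R : RouterLanguage} (hR : R.Effective) {n s : ℕ → ℕ} (hn : Primrec n)
    (hs : Primrec s) (hsn : ∀ y, s y ≤ n y ^ 2) :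
    ∃ c, ∀ y, ∀ G ∈ compactlyRouted R (n y) (s y),
      kolmogorovComplexity U (graphCode G) y ≤ s y + excessBits (n y) + c := by
  obtain ⟨c, hc⟩ := exists_kolmogorovComplexity_le hU
    (X := fun y => graphCode '' compactlyRouted R (n y) (s y))
    (rePred_mem_graphCode_compactlyRouted hR hn hs)
  refine ⟨c, fun y G hG => hc y _ ((Set.toFinite _).image _) ?_ _ (Set.mem_image_of_mem _ hG)⟩
  exact (Set.ncard_image_le (Set.toFinite _)).trans (ncard_compactlyRouted_le R (hsn y))

/-! ### The lower bound -/

theorem LabelModel.Allows.length_label_le {n : ℕ} {l : Fin n → List Bool} {lm : LabelModel}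
    (h : lm.Allows l) (u : Fin n) : (l u).length ≤ lm.labelCost (l u) + n.size := by
  have hbits (v : Fin n) : (initialLabel v).length ≤ n.size := by
    rw [initialLabel, Nat.size_eq_bits_len]
    exact Nat.size_le_size v.2
  cases lm with
  | α =>
    obtain rfl : l = initialLabel := h
    exact (hbits u).trans (Nat.le_add_left _ _)
  | β =>
    obtain ⟨σ, rfl⟩ := h
    exact (hbits _).trans (Nat.le_add_left _ _)
  | γ => exact Nat.le_add_right _ _

theorem RoutingScheme.dataBits_nodeData_le {n : ℕ} {G : SimpleGraph (Fin n)} {S : RoutingScheme G}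
    {lm : LabelModel} (h : lm.Allows S.label) :
    dataBits S.nodeData ≤ S.totalBits lm + n * n.size := by
  calc dataBits S.nodeData
      ≤ ∑ u, ((S.stored u).length + lm.labelCost (S.label u) + n.size) :=
        Finset.sum_le_sum fun u _ =>
          (Nat.add_le_add_left (h.length_label_le u) _).trans_eq (Nat.add_assoc _ _ _).symm
    _ = S.totalBits lm + n * n.size := by
        simp only [Finset.sum_add_distrib, RoutingScheme.totalBits, Finset.sum_const,
          Finset.card_univ, Fintype.card_fin, smul_eq_mul]

theorem RoutingScheme.IsShortestPath.mem_compactlyRouted {R : RouterLanguage} {n s : ℕ}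
    {G : SimpleGraph (Fin n)} {S : RoutingScheme G} (hS : S.IsShortestPath R)
    (hs : dataBits S.nodeData ≤ s) : G ∈ compactlyRouted R n s := by
  refine ⟨S.nodeData, hs, fun u => ?_, hS.isCompatible⟩
  exact (Set.ncard_le_card (G.neighborSet u)).trans_eq (Nat.card_fin n)

theorem sq_div_add_excessBits_le (n : ℕ) :
    (n : ℝ) ^ 2 / 18 + excessBits n ≤ (n.choose 2 : ℕ) + n + 5 * (n * n.size) := by
  obtain ⟨k, r, hr, hn⟩ : ∃ k r, r < 9 ∧ n = 9 * k + r :=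
    ⟨n / 9, n % 9, Nat.mod_lt _ (by norm_num), (Nat.div_add_mod n 9).symm⟩
  have hdiv : n / 9 = k := by omega
  have hn' : (n : ℝ) = 9 * k + r := by exact_mod_cast hn
  have hr' : (r : ℝ) ≤ 8 := by exact_mod_cast Nat.le_of_lt_succ hr
  rw [excessBits, hdiv]
  push_cast
  rw [Nat.cast_choose_two, Nat.cast_choose_two, Nat.cast_sub (by omega)]
  push_cast
  rw [hn']
  nlinarith [(Nat.cast_nonneg r : (0 : ℝ) ≤ r), (Nat.cast_nonneg k : (0 : ℝ) ≤ k)]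

theorem isLittleO_natCast_sq : (fun n : ℕ => (n : ℝ)) =o[atTop] fun n : ℕ => (n : ℝ) ^ 2 := by
  simpa only [pow_one] using (isLittleO_pow_pow_atTop_of_lt (𝕜 := ℝ) one_lt_two).natCast_atTop

theorem isLittleO_natCast_mul_size :
    (fun n : ℕ => ((n * n.size : ℕ) : ℝ)) =o[atTop] fun n : ℕ => (n : ℝ) ^ 2 := by
  have hlog : (fun n : ℕ => Real.logb 2 n) =o[atTop] fun n : ℕ => (n : ℝ) :=
    (Real.isLittleO_log_id_atTop.natCast_atTop.const_mul_left (Real.log 2)⁻¹).congr_left fun n =>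
      (div_eq_inv_mul (Real.log n) (Real.log 2)).symm
  have hone : (fun _ : ℕ => (1 : ℝ)) =o[atTop] fun n : ℕ => (n : ℝ) :=
    (isLittleO_const_id_atTop (1 : ℝ)).natCast_atTop
  have hsize : (fun n : ℕ => (n.size : ℝ)) =O[atTop] fun n : ℕ => Real.logb 2 n + 1 := by
    refine IsBigO.of_norm_le fun n => ?_
    have hle : n.size ≤ Nat.log 2 n + 1 := Nat.size_le.2 (Nat.lt_pow_succ_log_self one_lt_two n)
    calc ‖(n.size : ℝ)‖ = n.size := Real.norm_natCast _
      _ ≤ Nat.log 2 n + 1 := by exact_mod_cast hle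
      _ ≤ Real.logb 2 n + 1 := by gcongr; exact_mod_cast Real.natLog_le_logb n 2
  simpa only [Nat.cast_mul, sq] using
    (isBigO_refl (fun n : ℕ => (n : ℝ)) atTop).mul_isLittleO (hsize.trans_isLittleO (hlog.add hone))

/-- The number of bits of routing data that a graph on `n` nodes needs when its randomness
deficiency is `δ`, for the condition `y = ⟨n, δ⟩`. The last term `n` exceeds the additive constant
in the complexity bound for all large `n`. -/
def requiredBits (y : ℕ) : ℕ :=
  y.unpair.1.choose 2 - (y.unpair.2 + excessBits y.unpair.1 + y.unpair.1)

theorem requiredBits_pair (n δ : ℕ) :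
    requiredBits (Nat.pair n δ) = n.choose 2 - (δ + excessBits n + n) := by
  rw [requiredBits, Nat.unpair_pair]

theorem requiredBits_le (y : ℕ) : requiredBits y ≤ y.unpair.1 ^ 2 :=
  (Nat.sub_le _ _).trans (Nat.choose_le_pow _ 2)

theorem primrec_requiredBits : Primrec requiredBits := by
  have hn : Primrec fun y : ℕ => y.unpair.1 := Primrec.fst.comp Primrec.unpair
  have hδ : Primrec fun y : ℕ => y.unpair.2 := Primrec.snd.comp Primrec.unpair
  exact Primrec.nat_sub.comp (primrec_choose_two.comp hn)
    (Primrec.nat_add.comp (Primrec.nat_add.comp hδ (primrec_excessBits.comp hn)) hn)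

theorem exists_choose_two_lt_dataBits {U : List Bool × ℕ →. List Bool} (hU : IsUniversal U)
    {R : RouterLanguage} (hR : R.Effective) :
    ∃ c, ∀ (δ : ℕ → ℕ) (n : ℕ), c < n → ∀ G : SimpleGraph (Fin n), IsRandomGraph U δ G →
      ∀ S : RoutingScheme G, S.IsShortestPath R →
        n.choose 2 < dataBits S.nodeData + δ n + excessBits n + n := by
  obtain ⟨c, hc⟩ := exists_kolmogorovComplexity_graphCode_le hU hR
    (Primrec.fst.comp Primrec.unpair) primrec_requiredBits requiredBits_le
  refine ⟨c, fun δ n hn G hG S hS => ?_⟩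
  by_contra! hfew
  have hbits : dataBits S.nodeData ≤ requiredBits (Nat.pair n (δ n)) := by
    rw [requiredBits_pair]
    omega
  have hsimple := hc (Nat.pair n (δ n))
  rw [Nat.unpair_pair] at hsimple
  have hcomplexity : kolmogorovComplexity U (graphCode G) (Nat.pair n (δ n)) ≤
      requiredBits (Nat.pair n (δ n)) + excessBits n + c :=
    hsimple G (hS.mem_compactlyRouted hbits)
  have hle : kolmogorovComplexity U (graphCode G) (Nat.pair n (δ n)) + n + δ n ≤
      n.choose 2 + c := by
    rw [requiredBits_pair] at hcomplexity
    omega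
  have hrandom : (n.choose 2 : ℝ) - δ n ≤
      kolmogorovComplexity U (graphCode G) (Nat.pair n (δ n)) := by
    simpa only [IsRandomGraph, Nat.cast_choose_two] using hG
  have hle' : (kolmogorovComplexity U (graphCode G) (Nat.pair n (δ n)) : ℝ) + n + δ n ≤
      n.choose 2 + c := by exact_mod_cast hle
  have hn' : (c : ℝ) < n := by exact_mod_cast hn
  linarith

theorem mainTheorem7_general {U : List Bool × ℕ →. List Bool} (hU : IsUniversal U)
    {R : RouterLanguage} (hR : R.Effective) :
    ∃ c : ℕ, ∀ (δ : ℕ → ℕ) (n : ℕ) (G : SimpleGraph (Fin n)), IsRandomGraph U δ G →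
      ∀ (lm : LabelModel) (S : RoutingScheme G), lm.Allows S.label → S.IsShortestPath R →
        (n : ℝ) ^ 2 / 18 - (δ n + c * (n * n.size : ℕ)) ≤ S.totalBits lm := by
  obtain ⟨c, hc⟩ := exists_choose_two_lt_dataBits hU hR
  refine ⟨c + 8, fun δ n G hG lm S hl hS => ?_⟩
  have hn1 : (n : ℝ) ≤ n * n.size := by
    obtain rfl | hn := n.eq_zero_or_pos
    · simp
    · exact_mod_cast Nat.le_mul_of_pos_right n (Nat.size_pos.2 hn)
  push_cast
  obtain hn | hn := le_or_gt n c
  · have hsq : (n : ℝ) * n ≤ c * (n * n.size) := by gcongr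
    linarith [sq_nonneg (n : ℝ), (δ n).cast_nonneg (α := ℝ),
      (S.totalBits lm).cast_nonneg (α := ℝ)]
  · have hlt : (n.choose 2 : ℝ) < dataBits S.nodeData + δ n + excessBits n + n := by
      exact_mod_cast hc δ n hn G hG S hS
    have hdata : (dataBits S.nodeData : ℝ) ≤ S.totalBits lm + n * n.size := by
      exact_mod_cast S.dataBits_nodeData_le hl
    have hexcess := sq_div_add_excessBits_le n
    have hc0 : (0 : ℝ) ≤ c * (n * n.size) := by positivity
    linarith

theorem mainTheorem7
    (U : List Bool × ℕ →. List Bool) (hU : IsUniversal U)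
    (R : RouterLanguage) (hR : R.Effective)
    (δ : ℕ → ℕ) (hδ : (fun n : ℕ => (δ n : ℝ)) =o[atTop] (fun n : ℕ => (n : ℝ))) :
    ∃ g : ℕ → ℝ, g =o[atTop] (fun n : ℕ => (n : ℝ) ^ 2) ∧
      ∀ (n : ℕ) (G : SimpleGraph (Fin n)), IsRandomGraph U δ G →
        ∀ (pm : PortModel) (lm : LabelModel) (P₀ : PortAssignment G) (S : RoutingScheme G),
          pm.Allows P₀ S.port → lm.Allows S.label → S.IsShortestPath R →
            (n : ℝ) ^ 2 / 32 - g n ≤ (S.totalBits lm : ℝ) := by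
  obtain ⟨c, hc⟩ := mainTheorem7_general hU hR
  refine ⟨fun n => δ n + c * (n * n.size : ℕ), (hδ.trans isLittleO_natCast_sq).add
    (isLittleO_natCast_mul_size.const_mul_left c), fun n G hG _ lm _ S _ hl hS => ?_⟩
  linarith [hc δ n G hG lm S hl hS, sq_nonneg (n : ℝ)]
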